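/- Let $A$ be a finite-dimensional C*-algebra with a faithful tracial state $\tau$. For $1\le p<\infty$ and $x\in A$ put $\|x\|_p=\tau(|x|^p)^{1/p}$, where $|x|=(x^*x)^{1/2}$. Let $T:A\to A$ be a ($\mathbb C$-)linear map which is unital ($T1=1$) and trace preserving ($\tau(Tx)=\tau(x)$ for all $x\in A$); no positivity of $T$ is assumed. Then there exists $1<p<2$ such that $$\|Tx\|_2\le\|x\|_p\qquad\text{for all }x\in A$$ if and only if $$\lambda:=\sup_{x\in A\setminus\{0\},\ \tau(x)=0}\frac{\|Tx\|_2}{\|x\|_2}<1 .$$ Moreover, if these equivalent assertions hold, then there is $1<p<2$ such that both $\|Tx\|_2\le\|x\|_p$ for all $x\in A$ and $$\lambda\le c_p^{-1}\sqrt{p-1},\qquad\text{where } c_p=\sup_{x\in A\setminus\{0\},\ \tau(x)=0}\frac{\|x\|_2}{\|x\|_p}.$$ (Suprema are taken in $[0,\infty]$; if $A=\mathbb C$ the families are empty, $\lambda=c_p=0$ and $c_p^{-1}=\infty$.) -/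

import Mathlib

open scoped ENNReal ComplexOrder

/-- `τ` is a faithful tracial state on the unital C*-algebra `A`. -/
structure IsFaithfulTracialState {A : Type*} [CStarAlgebra A] [PartialOrder A]
    [StarOrderedRing A] (τ : A →ₗ[ℂ] ℂ) : Prop where
  nonneg : ∀ a : A, 0 ≤ a → 0 ≤ τ a
  map_one : τ 1 = 1
  tracial : ∀ a b : A, τ (a * b) = τ (b * a)
  faithful : ∀ a : A, 0 ≤ a → τ a = 0 → a = 0

/-- The noncommutative `L_p`-norm `‖x‖_p = (τ (|x| ^ p)) ^ (1 / p)`, where `|x| = (x* x) ^ (1 / 2)`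
and the power `|x| ^ p` is taken in the functional calculus. The number `τ (|x| ^ p)` is
nonnegative when `τ` is a state, so nothing is lost by taking its real part. -/
noncomputable def lpNorm {A : Type*} [CStarAlgebra A] [PartialOrder A] [StarOrderedRing A]
    (τ : A →ₗ[ℂ] ℂ) (p : ℝ) (x : A) : ℝ :=
  (τ (CFC.abs x ^ p)).re ^ (1 / p)

/-- `λ = sup {‖T x‖₂ / ‖x‖₂ : x ≠ 0, τ x = 0}`, as a supremum in `[0, ∞]`
(so that the supremum of the empty family is `0`). -/
noncomputable def gapConst {A : Type*} [CStarAlgebra A] [PartialOrder A] [StarOrderedRing A]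
    (τ : A →ₗ[ℂ] ℂ) (T : A →ₗ[ℂ] A) : ℝ≥0∞ :=
  ⨆ x ∈ {x : A | x ≠ 0 ∧ τ x = 0}, ENNReal.ofReal (lpNorm τ 2 (T x) / lpNorm τ 2 x)

/-- `c_p = sup {‖x‖₂ / ‖x‖_p : x ≠ 0, τ x = 0}`, as a supremum in `[0, ∞]`
(so that the supremum of the empty family is `0`). -/
noncomputable def normRatioConst {A : Type*} [CStarAlgebra A] [PartialOrder A] [StarOrderedRing A]
    (τ : A →ₗ[ℂ] ℂ) (p : ℝ) : ℝ≥0∞ :=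
  ⨆ x ∈ {x : A | x ≠ 0 ∧ τ x = 0}, ENNReal.ofReal (lpNorm τ 2 x / lpNorm τ p x)

/-! Split `x = τ(x)1 + y` with `τ y = 0`. Since `T` is unital and trace preserving, `‖Tx‖₂² = |τ x|²
+ ‖Ty‖₂²`, so only `y` matters.

If `‖Tx‖₂ ≤ ‖x‖_p` always, a trace zero `x` with `‖Tx‖₂ ≥ ‖x‖₂` saturates `‖·‖_p ≤ ‖·‖₂`, and so
does `1 + x`. Equality there (`lpNorm_sq_le`) makes `x* x` and `(1 + x)*(1 + x)` scalar, whence `x +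
x* = 0`. The same for `ix` gives `x = 0`; compactness of the sphere then yields `λ < 1`.

Conversely, `‖x‖_p² ≥ ‖x‖₂² - ε‖y‖₂²` with `ε → 0` as `p → 2` (`exists_le_lpNorm_sq`), because the
defect is governed by the variance of `x* x`, which is quadratic in `y`. Once `ε < 1 - λ²`, the
contraction of `y` absorbs the loss. On trace zero elements the same estimate gives `c_p⁻² ≥ 1 - ε`,
which settles the last bound for `p` near `2`. -/

/-- `τ (x* x)`, the square of the `L₂`-norm of `x`. -/
noncomputable def sqNorm {A : Type*} [CStarAlgebra A] (τ : A →ₗ[ℂ] ℂ) (x : A) : ℝ :=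
  (τ (star x * x)).re

/-! ### Scalar inequalities for `u ^ s` -/

/-- Write `u ^ s = u * exp (-(1 - s) * log u)`; then use `exp t ≥ 1 + t` and `log u ≤ u - 1`. -/
theorem rpow_ge_sub_mul_sq_sub {s u : ℝ} (hs0 : 0 < s) (hs : s ≤ 1) (hu : 0 ≤ u) :
    u - (1 - s) * (u * u - u) ≤ u ^ s := by
  rcases hu.eq_or_lt with rfl | hu
  · simp [Real.zero_rpow hs0.ne']
  have h1 : u ^ s = u * Real.exp (-(1 - s) * Real.log u) := by
    rw [Real.rpow_def_of_pos hu]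
    nth_rw 2 [← Real.exp_log hu]
    rw [← Real.exp_add]
    congr 1
    ring
  have h2 := Real.add_one_le_exp (-(1 - s) * Real.log u)
  have h3 := Real.log_le_sub_one_of_pos hu
  have h4 : 1 - (1 - s) * (u - 1) ≤ Real.exp (-(1 - s) * Real.log u) := by
    nlinarith [mul_le_mul_of_nonneg_left h3 (sub_nonneg.2 hs)]
  rw [h1]
  nlinarith [mul_le_mul_of_nonneg_left h4 hu.le]

theorem rpow_ge_quadratic {s u R : ℝ} (hs0 : 0 < s) (hs : s ≤ 1) (hu : 0 ≤ u) (hR : 0 < R) :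
    R ^ s * ((R⁻¹ + (1 - s) * R⁻¹) * u - (1 - s) * (R⁻¹ * R⁻¹) * (u * u)) ≤ u ^ s := by
  have h := rpow_ge_sub_mul_sq_sub hs0 hs (show 0 ≤ R⁻¹ * u by positivity)
  have h2 : u ^ s = R ^ s * (R⁻¹ * u) ^ s := by
    rw [← Real.mul_rpow hR.le (by positivity), mul_inv_cancel_left₀ hR.ne']
  rw [h2]
  refine mul_le_mul_of_nonneg_left (le_of_eq_of_le ?_ h) (by positivity)
  ring

theorem rpow_lt_tangent {s u R : ℝ} (hs0 : 0 < s) (hs : s < 1) (hu : 0 ≤ u) (hR : 0 < R)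
    (hne : u ≠ R) : u ^ s < R ^ s * ((1 - s) + s * R⁻¹ * u) := by
  have h2 : u ^ s = R ^ s * (R⁻¹ * u) ^ s := by
    rw [← Real.mul_rpow hR.le (by positivity), mul_inv_cancel_left₀ hR.ne']
  have h0 : 0 ≤ R⁻¹ * u := by positivity
  have h := rpow_one_add_lt_one_add_mul_self (s := R⁻¹ * u - 1) (by linarith)
    (fun h => hne (by field_simp at h; linarith)) hs0 hs
  rw [add_sub_cancel] at h
  rw [h2]
  refine mul_lt_mul_of_pos_left (h.trans_eq ?_) (by positivity)
  ring

/-! ### Algebraic identities for `sqNorm` -/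

section Algebra

variable {A : Type*} [CStarAlgebra A] {τ : A →ₗ[ℂ] ℂ}

theorem re_map_real_smul (r : ℝ) (x : A) : (τ (r • x)).re = r * (τ x).re := by
  rw [← Complex.coe_smul, map_smul]
  simp

theorem sqNorm_smul (c : ℂ) (x : A) : sqNorm τ (c • x) = ‖c‖ ^ 2 * sqNorm τ x := by
  have : star (c • x) * (c • x) = ((‖c‖ ^ 2 : ℝ) : ℂ) • (star x * x) := by
    rw [star_smul, smul_mul_smul_comm]
    congr 1
    rw [Complex.ofReal_pow, ← Complex.conj_mul']
    rfl
  rw [sqNorm, this, map_smul, smul_eq_mul, Complex.re_ofReal_mul, sqNorm]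

theorem star_mul_self_algebraMap_add (c : ℂ) (y : A) :
    star (algebraMap ℂ A c + y) * (algebraMap ℂ A c + y) =
      algebraMap ℂ A ((‖c‖ ^ 2 : ℝ) : ℂ) + (star c • y + c • star y + star y * y) := by
  have h : ((‖c‖ ^ 2 : ℝ) : ℂ) = star c * c := by
    rw [Complex.ofReal_pow, ← Complex.conj_mul']; rfl
  simp only [Algebra.algebraMap_eq_smul_one, h, star_add, star_smul, star_one, add_mul, mul_add,
    mul_one, one_mul, smul_mul_assoc, mul_smul_comm, smul_add, smul_smul, mul_comm c]
  abel

end Algebra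

/-! ### The trace, functional calculus and `‖·‖_p ≤ ‖·‖₂` -/

section State

variable {A : Type*} [CStarAlgebra A] [PartialOrder A] [StarOrderedRing A] {τ : A →ₗ[ℂ] ℂ}

namespace IsFaithfulTracialState

theorem map_star (hτ : IsFaithfulTracialState τ) (x : A) : τ (star x) = star (τ x) :=
  StarHomClass.map_star (PositiveLinearMap.mk₀ τ hτ.nonneg) x

theorem re_mono (hτ : IsFaithfulTracialState τ) {a b : A} (h : a ≤ b) : (τ a).re ≤ (τ b).re := by
  have := (Complex.le_def.1 (hτ.nonneg (b - a) (sub_nonneg.2 h))).1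
  simp only [map_sub, Complex.sub_re, Complex.zero_re] at this
  linarith

theorem map_eq_ofReal (hτ : IsFaithfulTracialState τ) {a : A} (h : 0 ≤ a) :
    τ a = ((τ a).re : ℂ) := by
  have := (Complex.le_def.1 (hτ.nonneg a h)).2
  exact Complex.ext rfl (by simpa using this.symm)

theorem eq_zero_of_re (hτ : IsFaithfulTracialState τ) {a : A} (h : 0 ≤ a) (h0 : (τ a).re = 0) :
    a = 0 :=
  hτ.faithful a h (by rw [hτ.map_eq_ofReal h, h0]; simp)

theorem map_algebraMap (hτ : IsFaithfulTracialState τ) (c : ℂ) : τ (algebraMap ℂ A c) = c := by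
  rw [Algebra.algebraMap_eq_smul_one, map_smul, hτ.map_one, smul_eq_mul, mul_one]

theorem sqNorm_nonneg (hτ : IsFaithfulTracialState τ) (x : A) : 0 ≤ sqNorm τ x :=
  (Complex.le_def.1 (hτ.nonneg _ (star_mul_self_nonneg x))).1

theorem sqNorm_eq_zero (hτ : IsFaithfulTracialState τ) {x : A} : sqNorm τ x = 0 ↔ x = 0 := by
  refine ⟨fun h => CStarRing.star_mul_self_eq_zero_iff x |>.1
    (hτ.eq_zero_of_re (star_mul_self_nonneg x) h), ?_⟩
  rintro rfl
  simp [sqNorm]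

theorem sqNorm_pos (hτ : IsFaithfulTracialState τ) {x : A} (hx : x ≠ 0) : 0 < sqNorm τ x :=
  (hτ.sqNorm_nonneg x).lt_of_ne fun h => hx (hτ.sqNorm_eq_zero.1 h.symm)

theorem sqNorm_le_norm_sq (hτ : IsFaithfulTracialState τ) (x : A) : sqNorm τ x ≤ ‖x‖ ^ 2 := by
  have h := hτ.re_mono (CStarAlgebra.star_mul_le_algebraMap_norm_sq (a := x))
  rw [Algebra.algebraMap_eq_smul_one, re_map_real_smul, hτ.map_one] at h
  simpa [sqNorm] using h

theorem sqNorm_algebraMap_add (hτ : IsFaithfulTracialState τ) (c : ℂ) {y : A} (hy : τ y = 0) :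
    sqNorm τ (algebraMap ℂ A c + y) = ‖c‖ ^ 2 + sqNorm τ y := by
  rw [sqNorm, star_mul_self_algebraMap_add]
  simp only [map_add, map_smul, hτ.map_star, hy, hτ.map_algebraMap, star_zero, smul_zero,
    zero_add, Complex.add_re, Complex.ofReal_re, sqNorm]

end IsFaithfulTracialState

theorem abs_rpow_eq (x : A) {p : ℝ} (hp : 0 ≤ p) :
    CFC.abs x ^ p = (star x * x) ^ (p / 2) := by
  rw [CFC.abs, CFC.sqrt_eq_rpow, CFC.rpow_rpow_of_exponent_nonneg _ _ _ (by norm_num) hp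
    (star_mul_self_nonneg x)]
  congr 1
  ring

theorem lpNorm_sq_eq (hτ : IsFaithfulTracialState τ) (x : A) {p : ℝ} (hp : 0 < p) :
    lpNorm τ p x ^ 2 = (τ ((star x * x) ^ (p / 2))).re ^ (p / 2)⁻¹ := by
  rw [lpNorm, abs_rpow_eq x hp.le, ← Real.rpow_natCast, ← Real.rpow_mul]
  · congr 1
    field_simp
    norm_num
  · exact (Complex.le_def.1 (hτ.nonneg _ CFC.rpow_nonneg)).1

theorem lpNorm_nonneg (hτ : IsFaithfulTracialState τ) (x : A) (p : ℝ) : 0 ≤ lpNorm τ p x :=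
  Real.rpow_nonneg (Complex.le_def.1 (hτ.nonneg _ CFC.rpow_nonneg)).1 _

theorem lpNorm_two_sq (hτ : IsFaithfulTracialState τ) (x : A) :
    lpNorm τ 2 x ^ 2 = sqNorm τ x := by
  rw [lpNorm_sq_eq hτ x two_pos, div_self two_ne_zero, CFC.rpow_one _ (star_mul_self_nonneg x),
    inv_one, Real.rpow_one, sqNorm]

theorem lpNorm_two (hτ : IsFaithfulTracialState τ) (x : A) :
    lpNorm τ 2 x = √(sqNorm τ x) := by
  rw [← lpNorm_two_sq hτ, Real.sqrt_sq (lpNorm_nonneg hτ x 2)]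

theorem rpow_ge_quadratic_cfc {a : A} (ha : 0 ≤ a) {s R : ℝ} (hs0 : 0 < s) (hs : s ≤ 1)
    (hR : 0 < R) :
    R ^ s • ((R⁻¹ + (1 - s) * R⁻¹) • a - ((1 - s) * (R⁻¹ * R⁻¹)) • (a * a)) ≤ a ^ s := by
  have hsa : IsSelfAdjoint a := .of_nonneg ha
  have hc : ContinuousOn (fun u : ℝ => u ^ s) (spectrum ℝ a) :=
    (Real.continuous_rpow_const hs0.le).continuousOn
  rw [CFC.rpow_eq_cfc_real]
  have : R ^ s • ((R⁻¹ + (1 - s) * R⁻¹) • a - ((1 - s) * (R⁻¹ * R⁻¹)) • (a * a)) =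
      cfc (fun u : ℝ => R ^ s • ((R⁻¹ + (1 - s) * R⁻¹) • u -
        ((1 - s) * (R⁻¹ * R⁻¹)) • (u * u))) a := by
    rw [cfc_smul .., cfc_sub .., cfc_smul .., cfc_smul .., cfc_mul .., cfc_id' ..]
  rw [this]
  refine cfc_mono (fun u hu => ?_)
  simpa only [smul_eq_mul] using
    rpow_ge_quadratic hs0 hs (spectrum_nonneg_of_nonneg ha hu) hR

theorem rpow_le_tangent_cfc {a : A} (ha : 0 ≤ a) {s R : ℝ} (hs0 : 0 < s) (hs : s < 1)
    (hR : 0 < R) :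
    a ^ s ≤ R ^ s • (algebraMap ℝ A (1 - s) + (s * R⁻¹) • a) ∧
      (a ^ s = R ^ s • (algebraMap ℝ A (1 - s) + (s * R⁻¹) • a) → a = algebraMap ℝ A R) := by
  have hsa : IsSelfAdjoint a := .of_nonneg ha
  have hc : ContinuousOn (fun u : ℝ => u ^ s) (spectrum ℝ a) :=
    (Real.continuous_rpow_const hs0.le).continuousOn
  rw [CFC.rpow_eq_cfc_real]
  have : R ^ s • (algebraMap ℝ A (1 - s) + (s * R⁻¹) • a) =
      cfc (fun u : ℝ => R ^ s • ((1 - s) + (s * R⁻¹) • u)) a := by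
    rw [cfc_smul .., cfc_const_add .., cfc_smul .., cfc_id' ..]
  rw [this]
  refine ⟨cfc_mono fun u hu => ?_, fun h => ?_⟩
  · rcases eq_or_ne u R with rfl | hne
    · refine le_of_eq ?_
      simp only [smul_eq_mul]
      field_simp
      ring
    · simpa only [smul_eq_mul] using
        (rpow_lt_tangent hs0 hs (spectrum_nonneg_of_nonneg ha hu) hR hne).le
  -- The tangent touches the graph only at `R`, so the spectrum of `a` lies in `{R}`.
  · have he := eqOn_of_cfc_eq_cfc h
    rw [← cfc_const R a, ← cfc_id' ℝ a]
    nth_rw 2 [cfc_id' ℝ a]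
    refine cfc_congr fun u hu => ?_
    by_contra hne
    have := he hu
    simp only [smul_eq_mul] at this
    exact (rpow_lt_tangent hs0 hs (spectrum_nonneg_of_nonneg ha hu) hR hne).ne this

namespace IsFaithfulTracialState

theorem map_sub_algebraMap (hτ : IsFaithfulTracialState τ) (x : A) :
    τ (x - algebraMap ℂ A (τ x)) = 0 := by
  rw [map_sub, hτ.map_algebraMap, sub_self]

theorem sqNorm_eq_add (hτ : IsFaithfulTracialState τ) (x : A) :
    sqNorm τ x = ‖τ x‖ ^ 2 + sqNorm τ (x - algebraMap ℂ A (τ x)) := by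
  rw [← hτ.sqNorm_algebraMap_add _ (hτ.map_sub_algebraMap x), add_sub_cancel]

theorem sqNorm_sub_algebraMap (hτ : IsFaithfulTracialState τ) {a : A} (ha : IsSelfAdjoint a) :
    sqNorm τ (a - algebraMap ℂ A ((τ a).re : ℂ)) = (τ (a * a)).re - (τ a).re ^ 2 := by
  have him : τ a = ((τ a).re : ℂ) := by
    have h := hτ.map_star a
    rw [ha.star_eq] at h
    exact (Complex.conj_eq_iff_re.1 h.symm).symm
  have h := hτ.sqNorm_eq_add a
  rw [him] at h
  rw [sqNorm, ha.star_eq] at h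
  simp only [Complex.norm_real, Real.norm_eq_abs, sq_abs] at h
  linarith

/-- Apply `τ` to the tangent of `u ^ s` at `R = τ (x* x)`; faithfulness turns equality of traces
into equality of operators. -/
theorem lpNorm_sq_le (hτ : IsFaithfulTracialState τ) (x : A) {p : ℝ} (hp0 : 0 < p) (hp : p < 2) :
    lpNorm τ p x ^ 2 ≤ sqNorm τ x ∧
      (sqNorm τ x ≤ lpNorm τ p x ^ 2 → star x * x = algebraMap ℝ A (sqNorm τ x)) := by
  rcases eq_or_ne x 0 with rfl | hx
  · have h0 : lpNorm τ p (0 : A) = 0 := by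
      have : lpNorm τ p (0 : A) = (τ (CFC.rpow (0 : A) p)).re ^ (1 / p) := by
        rw [lpNorm, CFC.abs_zero]; rfl
      rw [this, CFC.zero_rpow hp0.ne', map_zero, Complex.zero_re,
        Real.zero_rpow (by positivity)]
    simp [h0, sqNorm]
  have hR := hτ.sqNorm_pos hx
  have hs0 : 0 < p / 2 := by positivity
  obtain ⟨hle, heq⟩ := rpow_le_tangent_cfc (star_mul_self_nonneg x) hs0
    (show p / 2 < 1 by linarith) hR
  rw [lpNorm_sq_eq hτ x hp0]
  set s := p / 2
  set a := star x * x
  have hRa : (τ a).re = sqNorm τ x := rfl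
  set R := sqNorm τ x
  have hright : (τ (R ^ s • (algebraMap ℝ A (1 - s) + (s * R⁻¹) • a))).re = R ^ s := by
    rw [re_map_real_smul, map_add, Complex.add_re, re_map_real_smul, hRa,
      Algebra.algebraMap_eq_smul_one, re_map_real_smul, hτ.map_one, Complex.one_re]
    field_simp
    ring
  have ht0 : 0 ≤ (τ (a ^ s)).re := (Complex.le_def.1 (hτ.nonneg _ CFC.rpow_nonneg)).1
  have hle' := hτ.re_mono hle
  rw [hright] at hle'
  have hinv : (R ^ s) ^ s⁻¹ = R := Real.rpow_rpow_inv hR.le hs0.ne'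
  refine ⟨?_, fun h => heq ?_⟩
  · calc _ ≤ (R ^ s) ^ s⁻¹ := Real.rpow_le_rpow ht0 hle' (by positivity)
      _ = R := hinv
  · have h1 : R ^ s ≤ (τ (a ^ s)).re := by
      calc R ^ s ≤ ((τ (a ^ s)).re ^ s⁻¹) ^ s := Real.rpow_le_rpow hR.le h hs0.le
        _ = _ := Real.rpow_inv_rpow ht0 hs0.ne'
    refine (sub_eq_zero.1 (hτ.eq_zero_of_re (sub_nonneg.2 hle) ?_)).symm
    rw [map_sub, Complex.sub_re, hright]
    linarith

end IsFaithfulTracialState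

end State

/-! ### Estimates using finite dimension -/

section FiniteDimensional

variable {A : Type*} [CStarAlgebra A] [FiniteDimensional ℂ A]

theorem continuous_sqNorm (τ : A →ₗ[ℂ] ℂ) : Continuous (sqNorm τ) := by
  have := τ.continuous_of_finiteDimensional
  unfold sqNorm
  fun_prop

variable [PartialOrder A] [StarOrderedRing A] {τ : A →ₗ[ℂ] ℂ}

namespace IsFaithfulTracialState

/-- A continuous 2-homogeneous function attains its maximal ratio to `sqNorm τ` on every nonzero
subspace. -/
theorem exists_max_ratio (hτ : IsFaithfulTracialState τ) {f : A → ℝ} (hf : Continuous f)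
    (hf_smul : ∀ (c : ℂ) x, f (c • x) = ‖c‖ ^ 2 * f x) {S : Submodule ℂ A} (hS : S ≠ ⊥) :
    ∃ z ∈ S, z ≠ 0 ∧ ∀ x ∈ S, f x ≤ f z / sqNorm τ z * sqNorm τ x := by
  have : ProperSpace A := FiniteDimensional.proper ℂ A
  have hne : ∀ x ∈ Metric.sphere (0 : A) 1 ∩ S, sqNorm τ x ≠ 0 := fun x hx h0 => by
    have := hτ.sqNorm_eq_zero.1 h0
    simp [this] at hx
  have hcont : ContinuousOn (fun x => f x / sqNorm τ x) (Metric.sphere (0 : A) 1 ∩ S) :=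
    hf.continuousOn.div (continuous_sqNorm τ).continuousOn hne
  have hcomp : IsCompact (Metric.sphere (0 : A) 1 ∩ (S : Set A)) :=
    (isCompact_sphere _ _).inter_right S.closed_of_finiteDimensional
  have hmem : ∀ x ∈ S, x ≠ 0 →
      ((‖x‖⁻¹ : ℝ) : ℂ) • x ∈ Metric.sphere (0 : A) 1 ∩ S := fun x hx hx0 =>
    ⟨by simp [norm_smul, hx0], S.smul_mem _ hx⟩
  obtain ⟨w, hw, hw0⟩ := S.ne_bot_iff.1 hS
  obtain ⟨z, hz, hmax⟩ := hcomp.exists_isMaxOn ⟨_, hmem w hw hw0⟩ hcont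
  refine ⟨z, hz.2, fun h => hne z hz (hτ.sqNorm_eq_zero.2 h), fun x hx => ?_⟩
  rcases eq_or_ne x 0 with rfl | hx0
  · have := hf_smul 0 0
    simp at this
    simp [this, sqNorm]
  have h := hmax (hmem x hx hx0)
  simp only [Set.mem_ofPred_eq] at h
  rwa [hf_smul, sqNorm_smul, mul_div_mul_left _ _ (by simp [hx0]),
    div_le_iff₀ (hτ.sqNorm_pos hx0)] at h

theorem exists_norm_sq_le (hτ : IsFaithfulTracialState τ) :
    ∃ K, 0 ≤ K ∧ ∀ x : A, ‖x‖ ^ 2 ≤ K * sqNorm τ x := by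
  have h1 : (1 : A) ≠ 0 := fun h => by
    have := hτ.map_one
    rw [h, map_zero] at this
    exact zero_ne_one this
  obtain ⟨z, -, -, h⟩ := hτ.exists_max_ratio (f := fun x => ‖x‖ ^ 2) (S := ⊤) (by fun_prop)
    (fun c x => by rw [norm_smul, mul_pow]) ((Submodule.ne_bot_iff _).2 ⟨1, trivial, h1⟩)
  exact ⟨_, div_nonneg (sq_nonneg _) (hτ.sqNorm_nonneg z), fun x => h x trivial⟩

/-- Every term of `x* x - ‖x‖₂² 1`, expanded around `τ(x)1`, is at least linear in `y`, hence of
norm `O(‖y‖ ‖x‖₂)`; squaring and equivalence of norms finish. -/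
theorem exists_variance_star_mul_self_le (hτ : IsFaithfulTracialState τ) :
    ∃ C, 0 ≤ C ∧ ∀ x : A, (τ (star x * x * (star x * x))).re - sqNorm τ x ^ 2 ≤
      C * sqNorm τ (x - algebraMap ℂ A (τ x)) * sqNorm τ x := by
  obtain ⟨K, hK, hKn⟩ := hτ.exists_norm_sq_le
  refine ⟨K * (2 + 2 * √K) ^ 2, by positivity, fun x => ?_⟩
  set y := x - algebraMap ℂ A (τ x) with hy
  have hdec := hτ.sqNorm_eq_add x
  rw [← hy] at hdec
  set R := sqNorm τ x with hR
  set r := sqNorm τ y with hr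
  have hr0 : 0 ≤ r := hτ.sqNorm_nonneg y
  have hR0 : 0 ≤ R := hτ.sqNorm_nonneg x
  have hsplit : star x * x - algebraMap ℂ A (R : ℂ) =
      star (τ x) • y + τ x • star y + star y * y - algebraMap ℂ A (r : ℂ) := by
    have := star_mul_self_algebraMap_add (τ x) y
    rw [hy, add_sub_cancel, ← hy] at this
    rw [this, hdec, Complex.ofReal_add, RingHom.map_add]
    abel
  have hc : ‖τ x‖ ≤ √R := Real.le_sqrt_of_sq_le (by linarith)
  have hyn : ‖y‖ ≤ √K * √R := by
    rw [← Real.sqrt_mul hK]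
    refine Real.le_sqrt_of_sq_le ((hKn y).trans ?_)
    exact mul_le_mul_of_nonneg_left (by nlinarith [sq_nonneg ‖τ x‖]) hK
  have hrn : r ≤ ‖y‖ * ‖y‖ := by rw [← sq]; exact hτ.sqNorm_le_norm_sq y
  have : Nontrivial A := ⟨1, 0, fun h => by
    have := hτ.map_one
    rw [h, map_zero] at this
    exact zero_ne_one this⟩
  have hnorm : ‖star x * x - algebraMap ℂ A (R : ℂ)‖ ≤ ‖y‖ * √R * (2 + 2 * √K) := by
    rw [hsplit]
    calc _ ≤ ‖star (τ x) • y‖ + ‖τ x • star y‖ + ‖star y * y‖ + ‖algebraMap ℂ A (r : ℂ)‖ :=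
          (norm_sub_le _ _).trans (add_le_add_left (norm_add₃_le) _)
      _ = 2 * (‖τ x‖ * ‖y‖) + ‖y‖ * ‖y‖ + r := by
          rw [norm_smul, norm_smul, norm_star, norm_star, CStarRing.norm_star_mul_self,
            norm_algebraMap', Complex.norm_real, Real.norm_of_nonneg hr0]
          ring
      _ ≤ _ := by
          nlinarith [mul_le_mul_of_nonneg_right hc (norm_nonneg y),
            mul_le_mul_of_nonneg_right hyn (norm_nonneg y)]
  have h1 := hτ.sqNorm_sub_algebraMap (IsSelfAdjoint.star_mul_self x)
  change sqNorm τ (star x * x - algebraMap ℂ A (R : ℂ)) = _ - R ^ 2 at h1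
  rw [← h1]
  calc _ ≤ ‖star x * x - algebraMap ℂ A (R : ℂ)‖ ^ 2 := hτ.sqNorm_le_norm_sq _
    _ ≤ (‖y‖ * √R * (2 + 2 * √K)) ^ 2 := pow_le_pow_left₀ (norm_nonneg _) hnorm 2
    _ = ‖y‖ ^ 2 * (R * (2 + 2 * √K) ^ 2) := by
        rw [mul_pow, mul_pow, Real.sq_sqrt hR0]; ring
    _ ≤ K * r * (R * (2 + 2 * √K) ^ 2) :=
        mul_le_mul_of_nonneg_right (hKn y) (by positivity)
    _ = _ := by ring

/-- The `L_p`-norm is bounded below by the `L₂`-norm up to a multiple of the squared distance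
to the scalars which vanishes as `p = 2 * s` tends to `2`. -/
theorem exists_le_lpNorm_sq (hτ : IsFaithfulTracialState τ) :
    ∃ C, 0 ≤ C ∧ ∀ (x : A) (s : ℝ), 0 < s → s ≤ 1 →
      sqNorm τ x - (1 - s) / s * C * sqNorm τ (x - algebraMap ℂ A (τ x)) ≤
        lpNorm τ (2 * s) x ^ 2 := by
  obtain ⟨C, hC, h⟩ := hτ.exists_variance_star_mul_self_le
  refine ⟨C, hC, fun x s hs0 hs => ?_⟩
  rcases eq_or_ne x 0 with rfl | hx
  · simp only [map_zero, sub_self]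
    simp only [sqNorm, star_zero, mul_zero, map_zero, Complex.zero_re, sub_self]
    exact sq_nonneg _
  have hR := hτ.sqNorm_pos hx
  have hv := h x
  rw [lpNorm_sq_eq hτ x (by positivity), mul_div_cancel_left₀ s two_ne_zero]
  have hq := hτ.re_mono (rpow_ge_quadratic_cfc (star_mul_self_nonneg x) hs0 hs hR)
  rw [re_map_real_smul, map_sub, Complex.sub_re, re_map_real_smul, re_map_real_smul] at hq
  set a := star x * x with ha
  have hRa : (τ a).re = sqNorm τ x := rfl
  rw [hRa] at hq
  set R := sqNorm τ x
  set r := sqNorm τ (x - algebraMap ℂ A (τ x))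
  set t := (τ (a ^ s)).re with ht
  have hRs : 0 < R ^ s := Real.rpow_pos_of_pos hR s
  have ht0 : 0 ≤ t := (Complex.le_def.1 (hτ.nonneg _ CFC.rpow_nonneg)).1
  have h1 : 1 - (1 - s) * (C * r / R) ≤ t / R ^ s := by
    rw [le_div_iff₀ hRs, mul_comm]
    refine le_trans (mul_le_mul_of_nonneg_left ?_ hRs.le) hq
    have h2 : (τ (a * a)).re ≤ R ^ 2 + C * r * R := by linarith
    have h3 := mul_le_mul_of_nonneg_left h2
      (show 0 ≤ (1 - s) * (R⁻¹ * R⁻¹) from mul_nonneg (by linarith) (by positivity))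
    have h4 : (1 - s) * (R⁻¹ * R⁻¹) * (R ^ 2 + C * r * R) = (1 - s) * (1 + C * r / R) := by
      field_simp
    have h5 : (R⁻¹ + (1 - s) * R⁻¹) * R = 2 - s := by field_simp; ring
    rw [h5]
    linarith
  -- Bernoulli with exponent `1 / s ≥ 1` takes the outer root without losing the first-order bound.
  have h2 := one_add_mul_self_le_rpow_one_add (s := t / R ^ s - 1) (p := s⁻¹)
    (by have : 0 ≤ t / R ^ s := by positivity
        linarith) ((one_le_inv₀ hs0).2 hs)
  rw [add_sub_cancel, Real.div_rpow ht0 hRs.le, Real.rpow_rpow_inv hR.le hs0.ne',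
    le_div_iff₀ hR] at h2
  refine le_trans ?_ h2
  have h3 : -((1 - s) * (C * r / R)) ≤ t / R ^ s - 1 := by linarith
  have h4 := mul_le_mul_of_nonneg_left h3 (inv_nonneg.2 hs0.le)
  calc _ = (1 + s⁻¹ * -((1 - s) * (C * r / R))) * R := by field_simp; ring
    _ ≤ _ := mul_le_mul_of_nonneg_right (by linarith) hR.le

end IsFaithfulTracialState

end FiniteDimensional

/-! ### The spectral gap and both implications -/

section Gap

variable {A : Type*} [CStarAlgebra A] [PartialOrder A] [StarOrderedRing A] {τ : A →ₗ[ℂ] ℂ}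

theorem sqNorm_map_le_of_gapConst_lt_top (hτ : IsFaithfulTracialState τ) {T : A →ₗ[ℂ] A}
    (h : gapConst τ T < ∞) {x : A} (hx : τ x = 0) :
    sqNorm τ (T x) ≤ (gapConst τ T).toReal ^ 2 * sqNorm τ x := by
  rcases eq_or_ne x 0 with rfl | hx0
  · simp [sqNorm]
  have h1 : ENNReal.ofReal (lpNorm τ 2 (T x) / lpNorm τ 2 x) ≤ gapConst τ T :=
    le_iSup₂_of_le (f := fun x (_ : x ∈ {x : A | x ≠ 0 ∧ τ x = 0}) =>
      ENNReal.ofReal (lpNorm τ 2 (T x) / lpNorm τ 2 x)) x ⟨hx0, hx⟩ le_rfl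
  rw [ENNReal.ofReal_le_iff_le_toReal h.ne, lpNorm_two hτ, lpNorm_two hτ,
    div_le_iff₀ (Real.sqrt_pos.2 (hτ.sqNorm_pos hx0))] at h1
  have h2 := pow_le_pow_left₀ (Real.sqrt_nonneg _) h1 2
  rwa [mul_pow, Real.sq_sqrt (hτ.sqNorm_nonneg _), Real.sq_sqrt (hτ.sqNorm_nonneg _)] at h2

theorem gapConst_le_of_sqNorm_map_le (hτ : IsFaithfulTracialState τ) {T : A →ₗ[ℂ] A} {q : ℝ}
    (h : ∀ x, τ x = 0 → sqNorm τ (T x) ≤ q * sqNorm τ x) :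
    gapConst τ T ≤ ENNReal.ofReal √q := by
  refine iSup₂_le fun x hx => ENNReal.ofReal_le_ofReal ?_
  rw [lpNorm_two hτ, lpNorm_two hτ, ← Real.sqrt_div (hτ.sqNorm_nonneg _)]
  exact Real.sqrt_le_sqrt ((div_le_iff₀ (hτ.sqNorm_pos hx.1)).2 (h x hx.2))

theorem normRatioConst_le (hτ : IsFaithfulTracialState τ) {p b : ℝ} (hb : 0 < b)
    (h : ∀ x, τ x = 0 → b * sqNorm τ x ≤ lpNorm τ p x ^ 2) :
    normRatioConst τ p ≤ (ENNReal.ofReal √b)⁻¹ := by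
  refine iSup₂_le fun x hx => ?_
  rw [← ENNReal.ofReal_inv_of_pos (Real.sqrt_pos.2 hb)]
  refine ENNReal.ofReal_le_ofReal ?_
  have hpos : 0 < b * sqNorm τ x := mul_pos hb (hτ.sqNorm_pos hx.1)
  have h1 : √b * √(sqNorm τ x) ≤ lpNorm τ p x := by
    rw [← Real.sqrt_mul hb.le]
    exact Real.sqrt_le_iff.2 ⟨lpNorm_nonneg hτ x p, h x hx.2⟩
  have h2 : 0 < lpNorm τ p x := by
    refine lt_of_lt_of_le ?_ h1
    rw [← Real.sqrt_mul hb.le]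
    exact Real.sqrt_pos.2 hpos
  rw [lpNorm_two hτ, div_le_iff₀ h2, inv_mul_eq_div, le_div_iff₀ (Real.sqrt_pos.2 hb)]
  linarith

theorem sqNorm_map_eq_add (hτ : IsFaithfulTracialState τ) {T : A →ₗ[ℂ] A} (hT_one : T 1 = 1)
    (hT_trace : ∀ x : A, τ (T x) = τ x) (c : ℂ) {y : A} (hy : τ y = 0) :
    sqNorm τ (T (algebraMap ℂ A c + y)) = ‖c‖ ^ 2 + sqNorm τ (T y) := by
  have : T (algebraMap ℂ A c + y) = algebraMap ℂ A c + T y := by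
    simp [Algebra.algebraMap_eq_smul_one, hT_one]
  rw [this, hτ.sqNorm_algebraMap_add c (by rw [hT_trace, hy])]

/-- A hypercontractive unital trace preserving map strictly contracts the trace zero elements. -/
theorem sqNorm_map_lt_of_le_lpNorm (hτ : IsFaithfulTracialState τ) {T : A →ₗ[ℂ] A}
    (hT_one : T 1 = 1) (hT_trace : ∀ x : A, τ (T x) = τ x) {p : ℝ} (hp0 : 0 < p) (hp : p < 2)
    (hT : ∀ x, lpNorm τ 2 (T x) ≤ lpNorm τ p x) {x : A} (hx : τ x = 0) (hx0 : x ≠ 0) :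
    sqNorm τ (T x) < sqNorm τ x := by
  by_contra! hcon
  have key : ∀ z, sqNorm τ z ≤ sqNorm τ (T z) →
      star z * z = algebraMap ℝ A (sqNorm τ z) := fun z hz => by
    refine (hτ.lpNorm_sq_le z hp0 hp).2 (hz.trans ?_)
    rw [← lpNorm_two_sq hτ]
    exact pow_le_pow_left₀ (lpNorm_nonneg hτ _ _) (hT z) 2
  -- Both `y` and `1 + y` saturate; comparing their squares leaves only the cross terms.
  have skew : ∀ y, τ y = 0 → sqNorm τ y ≤ sqNorm τ (T y) → y + star y = 0 := fun y hy hle => by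
    have h1 := key (algebraMap ℂ A 1 + y) (by
      rw [sqNorm_map_eq_add hτ hT_one hT_trace 1 hy, hτ.sqNorm_algebraMap_add 1 hy]
      linarith)
    have h2 := key y hle
    rw [hτ.sqNorm_algebraMap_add 1 hy,
      star_mul_self_algebraMap_add, h2] at h1
    simp only [norm_one, one_pow, Complex.ofReal_one, map_one, star_one, one_smul,
      map_add] at h1
    simpa using h1
  have h1 := skew x hx hcon
  have h2 := skew (Complex.I • x) (by rw [map_smul, hx, smul_zero]) (by
    rw [map_smul, sqNorm_smul, sqNorm_smul]
    simpa using hcon)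
  have h3 : star (Complex.I • x) = Complex.I • x := by
    rw [star_smul, eq_neg_of_add_eq_zero_right h1]
    simp
  rw [h3, ← two_smul ℂ] at h2
  simp [hx0] at h2

theorem gapConst_lt_one_of_le_lpNorm [FiniteDimensional ℂ A] (hτ : IsFaithfulTracialState τ)
    {T : A →ₗ[ℂ] A} (hT_one : T 1 = 1) (hT_trace : ∀ x : A, τ (T x) = τ x) {p : ℝ} (hp0 : 0 < p)
    (hp : p < 2) (hT : ∀ x, lpNorm τ 2 (T x) ≤ lpNorm τ p x) : gapConst τ T < 1 := by
  obtain ⟨q, hq, h⟩ : ∃ q < 1, ∀ x, τ x = 0 → sqNorm τ (T x) ≤ q * sqNorm τ x := by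
    -- With a trivial kernel (`A = ℂ`) there is no maximizer, and any `q < 1` works.
    by_cases hS : LinearMap.ker τ = ⊥
    · refine ⟨0, one_pos, fun x hx => ?_⟩
      have : x = 0 := by
        rw [← Submodule.mem_bot ℂ, ← hS]
        exact hx
      simp [this, sqNorm]
    · obtain ⟨z, hz, hz0, h⟩ := hτ.exists_max_ratio (f := fun x => sqNorm τ (T x))
        ((continuous_sqNorm τ).comp T.continuous_of_finiteDimensional)
        (fun c x => by rw [map_smul, sqNorm_smul]) hS
      exact ⟨_, (div_lt_one (hτ.sqNorm_pos hz0)).2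
        (sqNorm_map_lt_of_le_lpNorm hτ hT_one hT_trace hp0 hp hT hz hz0), fun x hx => h x hx⟩
  refine (gapConst_le_of_sqNorm_map_le hτ h).trans_lt ?_
  rw [← ENNReal.ofReal_one, ENNReal.ofReal_lt_ofReal_iff one_pos]
  rw [Real.sqrt_lt' one_pos]
  simpa using hq

theorem exists_le_lpNorm_of_gapConst_lt_one [FiniteDimensional ℂ A]
    (hτ : IsFaithfulTracialState τ) {T : A →ₗ[ℂ] A} (hT_one : T 1 = 1)
    (hT_trace : ∀ x : A, τ (T x) = τ x) (hgap : gapConst τ T < 1) :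
    ∃ p : ℝ, 1 < p ∧ p < 2 ∧ (∀ x : A, lpNorm τ 2 (T x) ≤ lpNorm τ p x) ∧
      gapConst τ T ≤ (normRatioConst τ p)⁻¹ * ENNReal.ofReal (Real.sqrt (p - 1)) := by
  have hfin : gapConst τ T < ∞ := hgap.trans ENNReal.one_lt_top
  obtain ⟨C, hC, hlow⟩ := hτ.exists_le_lpNorm_sq
  have hT := fun x hx => sqNorm_map_le_of_gapConst_lt_top hτ (T := T) hfin (x := x) hx
  set l := (gapConst τ T).toReal with hl
  have hl0 : 0 ≤ l := ENNReal.toReal_nonneg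
  have hl1 : l ^ 2 < 1 := by
    have : l < 1 := by
      simpa using (ENNReal.toReal_lt_toReal hfin.ne ENNReal.one_ne_top).2 hgap
    exact pow_lt_one₀ hl0 this two_ne_zero
  -- Both conditions are strict at `s = 1`, where they read `0 < 1 - l²` and `l² < 1`; here `p = 2 *
  -- s`.
  have hev1 : ∀ᶠ s : ℝ in nhds 1, (1 - s) / s * C < 1 - l ^ 2 := by
    have : ContinuousAt (fun s : ℝ => (1 - s) / s * C) 1 := by
      fun_prop (disch := norm_num)
    exact this.eventually_lt continuousAt_const (by simpa using hl1)
  have hev2 : ∀ᶠ s : ℝ in nhds 1, l ^ 2 < (1 - (1 - s) / s * C) * (2 * s - 1) := by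
    have : ContinuousAt (fun s : ℝ => (1 - (1 - s) / s * C) * (2 * s - 1)) 1 := by
      fun_prop (disch := norm_num)
    exact continuousAt_const.eventually_lt this (by norm_num; simpa using hl1)
  obtain ⟨s, ⟨⟨h1, h2⟩, hs2⟩, hs1⟩ := (((hev1.and hev2).and
    (lt_mem_nhds (show (1 / 2 : ℝ) < 1 by norm_num))).filter_mono nhdsWithin_le_nhds |>.and
      (self_mem_nhdsWithin (a := (1 : ℝ)) (s := Set.Iio 1))).exists
  have hs0 : 0 < s := by linarith
  replace hs1 : s < 1 := hs1
  set ε := (1 - s) / s * C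
  refine ⟨2 * s, by linarith, by linarith, fun x => ?_, ?_⟩
  · refine (sq_le_sq₀ (lpNorm_nonneg hτ _ _) (lpNorm_nonneg hτ _ _)).1 ?_
    refine le_trans ?_ (hlow x s hs0 hs1.le)
    have hy := hτ.map_sub_algebraMap x
    have hTx := sqNorm_map_eq_add hτ hT_one hT_trace (τ x) hy
    rw [add_sub_cancel] at hTx
    rw [lpNorm_two_sq hτ, hTx, hτ.sqNorm_eq_add x]
    have := hT _ hy
    -- The loss `ε‖y‖₂²` is at most the gain `(1 - l²)‖y‖₂²`.
    have := mul_le_mul_of_nonneg_right h1.le (hτ.sqNorm_nonneg (x - algebraMap ℂ A (τ x)))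
    linarith
  · have hb : 0 < 1 - ε := by nlinarith
    have hr := normRatioConst_le hτ (p := 2 * s) hb fun x hx => by
      have := hlow x s hs0 hs1.le
      rw [hx, map_zero, sub_zero] at this
      linarith
    calc gapConst τ T = ENNReal.ofReal l := (ENNReal.ofReal_toReal hfin.ne).symm
      _ ≤ ENNReal.ofReal (√(1 - ε) * √(2 * s - 1)) := by
          rw [← Real.sqrt_mul hb.le]
          exact ENNReal.ofReal_le_ofReal (Real.le_sqrt_of_sq_le h2.le)
      _ = ENNReal.ofReal √(1 - ε) * ENNReal.ofReal √(2 * s - 1) :=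
          ENNReal.ofReal_mul (Real.sqrt_nonneg _)
      _ ≤ _ := mul_le_mul_left (ENNReal.le_inv_iff_le_inv.1 hr) _

end Gap

theorem mainTheorem2 {A : Type*} [CStarAlgebra A] [PartialOrder A] [StarOrderedRing A]
    [FiniteDimensional ℂ A] (τ : A →ₗ[ℂ] ℂ) (hτ : IsFaithfulTracialState τ)
    (T : A →ₗ[ℂ] A) (hT_one : T 1 = 1) (hT_trace : ∀ x : A, τ (T x) = τ x) :
    ((∃ p : ℝ, 1 < p ∧ p < 2 ∧ ∀ x : A, lpNorm τ 2 (T x) ≤ lpNorm τ p x) ↔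
      gapConst τ T < 1) ∧
    (gapConst τ T < 1 →
      ∃ p : ℝ, 1 < p ∧ p < 2 ∧ (∀ x : A, lpNorm τ 2 (T x) ≤ lpNorm τ p x) ∧
        gapConst τ T ≤ (normRatioConst τ p)⁻¹ * ENNReal.ofReal (Real.sqrt (p - 1))) := by
  have h := exists_le_lpNorm_of_gapConst_lt_one hτ hT_one hT_trace
  refine ⟨⟨?_, fun hgap => ?_⟩, h⟩
  · rintro ⟨p, hp1, hp2, hp⟩
    exact gapConst_lt_one_of_le_lpNorm hτ hT_one hT_trace (by linarith) hp2 hp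
  · obtain ⟨p, hp1, hp2, hp, -⟩ := h hgap
    exact ⟨p, hp1, hp2, hp⟩
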